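/- Let $\mathcal H$ be a right quaternionic Hilbert space: a right $\mathbb H$-module with an $\mathbb H$-valued inner product $\langle x|y\rangle$ satisfying $\langle x|yp+zq\rangle=\langle x|y\rangle p+\langle x|z\rangle q$, $\langle x|y\rangle=\overline{\langle y|x\rangle}$, $\langle x|x\rangle\ge 0$ with equality only for $x=0$, and complete for $\|x\|=\langle x|x\rangle^{1/2}$. Let $\mathcal B(\mathcal H)$ be the set of bounded right $\mathbb H$-linear operators on $\mathcal H$, and let $\mathbb S=\{q\in\mathbb H:\overline q=-q,\ |q|=1\}$. Let $m,n\in\mathbb S$ with $mn=-nm$, let $\mathbb C_m=\{\alpha+m\beta:\alpha,\beta\in\mathbb R\}$, identified with $\mathbb C$ via $\alpha+m\beta\mapsto\alpha+i\beta$, let $J\in\mathcal B(\mathcal H)$ be anti self-adjoint ($J^*=-J$) and unitary, and let $\mathcal H^{Jm}_+=\{x\in\mathcal H: Jx=x\cdot m\}$, which is a complex inner product space under right multiplication by $\mathbb C_m$ and the restriction of $\langle\cdot|\cdot\rangle$. Let $T\in\mathcal B(\mathcal H)$ be normal and let $T_+$ be a bounded $\mathbb C_m$-linear operator on $\mathcal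 H^{Jm}_+$ with $\widetilde{T_+}=T$, i.e. $T$ is the right $\mathbb H$-linear extension of $T_+$ to $\mathcal H$. Let $\Sigma$ be the Borel $\sigma$-algebra of the spectrum $\sigma(T_+)\subseteq\mathbb C_m$ and let $E$ be the complex projection-valued spectral measure of $T_+$ on $\Sigma$: each $E(\omega)$ is a bounded self-adjoint projection on $\mathcal H^{Jm}_+$, $E(\emptyset)=0$, $E(\sigma(T_+))=I$, $E(\omega_1\cap\omega_2)=E(\omega_1)E(\omega_2)$, each $E_{a,b}(\omega)=\langle a|E(\omega)b\rangle$ is a complex measure, and $\langle a|T_+b\rangle=\int_{\sigma(T_+)}\lambda\,dE_{a,b}(\lambda)$ for all $a,b\in\mathcal H^{Jm}_+$. Then for each $\omega\in\Sigma$ the operator $E(\omega)$ has a unique right $\mathbb H$-linear extension $\widetilde{E(\omega)}$ to $\mathcal H$, this extension is bounded, and $F\colon\Sigma\to\mathcal B(\mathcal H)$, $F(\omega):=\widetilde{E(\omega)}$, is a quaternionic projection-valued measure on $\sigma(T_+)$, that is: 1. $F(\emptyset)=0$ and $F(\sigma(T_+))=I$; 2. $F(\omega)^*=F(\omega)=F(\omega)^2$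 for all $\omega\in\Sigma$; 3. $F(\omega_1\cap\omega_2)=F(\omega_1)F(\omega_2)$ for all $\omega_1,\omega_2\in\Sigma$; 4. for all $x,y\in\mathcal H$, the map $F_{x,y}(\omega)=\langle x|F(\omega)y\rangle$ is a (countably additive) $\mathbb H$-valued measure on $\Sigma$. -/

import Mathlib

open MeasureTheory
open scoped Quaternion RightActions ComplexConjugate

noncomputable section

/-- The sphere `𝕊` of imaginary units of `ℍ`. -/
def imaginarySphere : Set ℍ[ℝ] := {q | star q = -q ∧ ‖q‖ = 1}

theorem imaginarySphere_mul_self (m : imaginarySphere) : (m : ℍ[ℝ]) * m = -1 := by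
  have h := Quaternion.self_mul_star (m : ℍ[ℝ])
  rw [m.2.1, Quaternion.normSq_eq_norm_mul_self, m.2.2] at h
  simp only [mul_neg, mul_one, Quaternion.coe_one] at h
  exact neg_eq_iff_eq_neg.mp h

/-- The embedding `α + i β ↦ α + m β` of `ℂ` into `ℍ`; its range is the slice `ℂ_m`. -/
def sliceEmb (m : imaginarySphere) : ℂ →ₐ[ℝ] ℍ[ℝ] :=
  Complex.liftAux (m : ℍ[ℝ]) (imaginarySphere_mul_self m)

theorem sliceEmb_apply (m : imaginarySphere) (z : ℂ) :
    sliceEmb m z = (z.re : ℍ[ℝ]) + (m : ℍ[ℝ]) * (z.im : ℍ[ℝ]) := by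
  rw [sliceEmb, Complex.liftAux_apply, Quaternion.mul_coe_eq_smul]
  rfl

theorem star_sliceEmb (m : imaginarySphere) (z : ℂ) :
    star (sliceEmb m z) = sliceEmb m (conj z) := by
  simp only [sliceEmb_apply, star_add, star_mul, Quaternion.star_coe, m.2.1, Complex.conj_re,
    Complex.conj_im, Quaternion.coe_neg, mul_neg, Quaternion.coe_commutes]

/-- The `ℂ_m`-coordinate of a quaternion: the orthogonal projection of `ℍ` onto `ℂ_m`, followed by
the identification of `ℂ_m` with `ℂ`. It is the inverse of `sliceEmb m` on `ℂ_m`. -/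
def sliceCoord (m : imaginarySphere) (q : ℍ[ℝ]) : ℂ := ⟨q.re, (star (m : ℍ[ℝ]) * q).re⟩

theorem sliceCoord_add (m : imaginarySphere) (p q : ℍ[ℝ]) :
    sliceCoord m (p + q) = sliceCoord m p + sliceCoord m q := by
  apply Complex.ext <;> simp [sliceCoord, mul_add]

theorem sliceCoord_mul (m : imaginarySphere) (z : ℂ) (q : ℍ[ℝ]) :
    sliceCoord m (sliceEmb m z * q) = z * sliceCoord m q := by
  have hm := imaginarySphere_mul_self m
  have key : star (m : ℍ[ℝ]) * (sliceEmb m z * q) = z.re • (star (m : ℍ[ℝ]) * q) + z.im • q := by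
    rw [sliceEmb, Complex.liftAux_apply, m.2.1, Algebra.algebraMap_eq_smul_one]
    simp only [add_mul, mul_add, smul_mul_assoc, mul_smul_comm, one_mul]
    rw [← mul_assoc (-m.1), neg_mul m.1 m.1, hm, neg_neg, one_mul]
  apply Complex.ext
  · simp [sliceCoord, m.2.1, sliceEmb, Complex.liftAux_apply, add_mul]
    ring
  · change (star (m : ℍ[ℝ]) * (sliceEmb m z * q)).re = _
    rw [key]
    simp [sliceCoord]

theorem sliceCoord_sliceEmb (m : imaginarySphere) (z : ℂ) : sliceCoord m (sliceEmb m z) = z := by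
  have h : sliceCoord m 1 = 1 := by
    have h0 : (m : ℍ[ℝ]).re = 0 := by
      have := congrArg (fun q : ℍ[ℝ] => q.re) m.2.1
      simp at this
      linarith
    apply Complex.ext <;> simp [sliceCoord, h0]
  simpa [h] using sliceCoord_mul m z 1

theorem sliceCoord_star (m : imaginarySphere) (q : ℍ[ℝ]) :
    sliceCoord m (star q) = conj (sliceCoord m q) := by
  have h1 : (star (m : ℍ[ℝ]) * star q).re = -(star (m : ℍ[ℝ]) * q).re := by
    have : (star (m : ℍ[ℝ]) * star q).re = (q * (m : ℍ[ℝ])).re := by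
      rw [← star_mul, Quaternion.re_star]
    rw [this, m.2.1]
    simp
    ring
  apply Complex.ext
  · simp [sliceCoord]
  · simpa [sliceCoord] using h1

/-- A quaternion that commutes with `m` lies in `ℂ_m`. -/
theorem sliceEmb_sliceCoord (m : imaginarySphere) {q : ℍ[ℝ]} (hq : q * m = m * q) :
    sliceEmb m (sliceCoord m q) = q := by
  have hm := imaginarySphere_mul_self m
  have h1 : m.1 * q = ((m.1 * q).re : ℍ[ℝ]) + q.re • m.1 := by
    have h2 := Quaternion.self_add_star' (m.1 * q)
    rw [star_mul, m.2.1, mul_neg] at h2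
    have h3 := Quaternion.self_add_star' q
    have h4 : star q = ((2 * q.re : ℝ) : ℍ[ℝ]) - q := by rw [← h3]; abel
    rw [h4, sub_mul, Quaternion.coe_mul_eq_smul, hq] at h2
    have h5 : (2 : ℝ) • (m.1 * q) = (2 : ℝ) • (((m.1 * q).re : ℍ[ℝ]) + q.re • m.1) := by
      rw [smul_add, smul_smul, two_smul ℝ (m.1 * q), ← Quaternion.coe_smul, smul_eq_mul, ← h2]
      abel
    exact smul_right_injective _ (two_ne_zero) h5
  have h6 : q = -(m.1 * (m.1 * q)) := by rw [← mul_assoc, hm]; simp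
  rw [sliceEmb_apply]
  simp only [sliceCoord]
  conv_rhs => rw [h6, h1]
  rw [mul_add, mul_smul_comm, hm, m.2.1, neg_mul, Quaternion.re_neg, Quaternion.coe_neg]
  rw [smul_neg, ← Quaternion.coe_mul_eq_smul, mul_one, mul_neg]
  abel

/-- A right quaternionic inner product space: a right `ℍ`-module with an `ℍ`-valued inner product,
conjugate linear in the first and linear in the second variable. The law `inner_self` says that
`⟨x | x⟩` is a non-negative real number that vanishes only for `x = 0`, and that the norm is
`‖x‖ = ⟨x | x⟩ ^ (1/2)`. A right quaternionic Hilbert space is one that is also complete. -/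
class QuaternionicInnerProductSpace (H : Type*) [NormedAddCommGroup H] extends
    Module ℍ[ℝ]ᵐᵒᵖ H where
  /-- The `ℍ`-valued inner product `⟨x | y⟩`. -/
  hinner : H → H → ℍ[ℝ]
  hinner_add : ∀ x y z, hinner x (y + z) = hinner x y + hinner x z
  hinner_smul : ∀ x y (q : ℍ[ℝ]), hinner x (y <• q) = hinner x y * q
  star_hinner : ∀ x y, star (hinner y x) = hinner x y
  hinner_self : ∀ x, hinner x x = ((‖x‖ ^ 2 : ℝ) : ℍ[ℝ])

open QuaternionicInnerProductSpace

section Operators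

variable {H : Type*} [NormedAddCommGroup H] [QuaternionicInnerProductSpace H]

theorem hinner_add_left (x y z : H) : hinner (x + y) z = hinner x z + hinner y z := by
  rw [← star_hinner, hinner_add, star_add, star_hinner, star_hinner]

theorem hinner_smul_left (x y : H) (q : ℍ[ℝ]) : hinner (x <• q) y = star q * hinner x y := by
  rw [← star_hinner, hinner_smul, star_mul, star_hinner]

theorem norm_right_smul (x : H) (q : ℍ[ℝ]) : ‖x <• q‖ = ‖x‖ * ‖q‖ := by
  have h : ((‖x <• q‖ ^ 2 : ℝ) : ℍ[ℝ]) = (((‖x‖ * ‖q‖) ^ 2 : ℝ) : ℍ[ℝ]) := by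
    rw [← hinner_self, hinner_smul, hinner_smul_left, hinner_self, mul_assoc,
      Quaternion.coe_mul_eq_smul, mul_smul_comm, Quaternion.star_mul_self,
      Quaternion.normSq_eq_norm_mul_self, ← Quaternion.coe_smul]
    congr 1
    simp only [smul_eq_mul]
    ring
  have h' := Quaternion.coe_injective h
  exact (pow_left_inj₀ (norm_nonneg _) (by positivity) two_ne_zero).mp h'

/-- `S` is the adjoint of `T`: `⟨x | T y⟩ = ⟨S x | y⟩` for all `x`, `y`. Bounded quaternionic
operators are the continuous right `ℍ`-linear maps `H →L[ℍ[ℝ]ᵐᵒᵖ] H`. -/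
def IsQAdjoint (T S : H →L[ℍ[ℝ]ᵐᵒᵖ] H) : Prop :=
  ∀ x y : H, hinner x (T y) = hinner (S x) y

/-- `T* T = T T*`. -/
def IsQNormal (T : H →L[ℍ[ℝ]ᵐᵒᵖ] H) : Prop :=
  ∃ S : H →L[ℍ[ℝ]ᵐᵒᵖ] H, IsQAdjoint T S ∧ S * T = T * S

/-- `T* = T`. -/
def IsQSelfAdjoint (T : H →L[ℍ[ℝ]ᵐᵒᵖ] H) : Prop := IsQAdjoint T T

/-- `T* = -T`. -/
def IsQAntiSelfAdjoint (T : H →L[ℍ[ℝ]ᵐᵒᵖ] H) : Prop := IsQAdjoint T (-T)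

/-- `T* T = T T* = I`. -/
def IsQUnitary (T : H →L[ℍ[ℝ]ᵐᵒᵖ] H) : Prop :=
  ∃ S : H →L[ℍ[ℝ]ᵐᵒᵖ] H, IsQAdjoint T S ∧ S * T = 1 ∧ T * S = 1

/-- The slice space `H₊^{Jm} = {x | J x = x m}`. -/
def sliceSpace (J : H →L[ℍ[ℝ]ᵐᵒᵖ] H) (m : imaginarySphere) : AddSubgroup H where
  carrier := {x | J x = x <• (m : ℍ[ℝ])}
  zero_mem' := by simp
  add_mem' := by
    intro x y hx hy
    simp only [Set.mem_ofPred_eq] at hx hy ⊢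
    rw [map_add, hx, hy, smul_add]
  neg_mem' := by
    intro x hx
    simp only [Set.mem_ofPred_eq] at hx ⊢
    rw [map_neg, hx, smul_neg]

variable {J : H →L[ℍ[ℝ]ᵐᵒᵖ] H} {m : imaginarySphere}

theorem mul_sliceEmb_comm (m : imaginarySphere) (z : ℂ) :
    (m : ℍ[ℝ]) * sliceEmb m z = sliceEmb m z * m := by
  rw [sliceEmb_apply, mul_add, add_mul, Quaternion.coe_commutes, mul_assoc, Quaternion.coe_commutes]

theorem right_smul_mem_sliceSpace {x : H} (hx : x ∈ sliceSpace J m) (z : ℂ) :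
    x <• sliceEmb m z ∈ sliceSpace J m := by
  have hx' : J x = x <• (m : ℍ[ℝ]) := hx
  change J (x <• sliceEmb m z) = (x <• sliceEmb m z) <• (m : ℍ[ℝ])
  rw [map_smul, hx', smul_smul, smul_smul, ← MulOpposite.op_mul, ← MulOpposite.op_mul,
    mul_sliceEmb_comm]

/-- The slice space is a complex vector space: `z = α + i β` acts as right multiplication by the
element `α + m β` of `ℂ_m`. -/
instance sliceSpace.instModule : Module ℂ (sliceSpace J m) where
  smul z x := ⟨(x : H) <• sliceEmb m z, right_smul_mem_sliceSpace x.2 z⟩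
  one_smul x := Subtype.ext <| by
    change (x : H) <• sliceEmb m 1 = x
    simp
  mul_smul z w x := Subtype.ext <| by
    change (x : H) <• sliceEmb m (z * w) = ((x : H) <• sliceEmb m w) <• sliceEmb m z
    rw [smul_smul, ← MulOpposite.op_mul, ← map_mul, mul_comm]
  smul_zero z := Subtype.ext <| by
    change (0 : H) <• sliceEmb m z = 0
    simp
  smul_add z x y := Subtype.ext <| by
    change ((x : H) + y) <• sliceEmb m z = (x : H) <• sliceEmb m z + (y : H) <• sliceEmb m z
    rw [smul_add]
  add_smul z w x := Subtype.ext <| by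
    change (x : H) <• sliceEmb m (z + w) = (x : H) <• sliceEmb m z + (x : H) <• sliceEmb m w
    rw [map_add, MulOpposite.op_add, add_smul]
  zero_smul x := Subtype.ext <| by
    change (x : H) <• sliceEmb m 0 = 0
    simp

theorem sliceSpace.coe_smul (z : ℂ) (x : sliceSpace J m) :
    ((z • x : sliceSpace J m) : H) = (x : H) <• sliceEmb m z := rfl

/-- The complex inner product of the slice space is the restriction of `⟨· | ·⟩`, read in `ℂ`
(see `sliceEmb_inner` for the fact that the restriction takes its values in `ℂ_m`). -/
instance sliceSpace.instInnerProductSpace : InnerProductSpace ℂ (sliceSpace J m) where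
  norm_smul_le z x := by
    change ‖(x : H) <• sliceEmb m z‖ ≤ ‖z‖ * ‖(x : H)‖
    have h : ‖sliceEmb m z‖ = ‖z‖ := by
      have h1 : ((‖sliceEmb m z‖ * ‖sliceEmb m z‖ : ℝ) : ℍ[ℝ]) = ((‖z‖ ^ 2 : ℝ) : ℍ[ℝ]) := by
        rw [← Quaternion.normSq_eq_norm_mul_self, ← Quaternion.self_mul_star, star_sliceEmb,
          ← map_mul, Complex.mul_conj, Complex.normSq_eq_norm_sq]
        rw [sliceEmb_apply, Complex.ofReal_re, Complex.ofReal_im, Quaternion.coe_zero, mul_zero,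
          add_zero]
      have h2 := Quaternion.coe_injective h1
      rw [← sq] at h2
      exact (pow_left_inj₀ (norm_nonneg _) (norm_nonneg _) two_ne_zero).mp h2
    rw [norm_right_smul, h, mul_comm]
  inner x y := sliceCoord m (hinner (x : H) (y : H))
  norm_sq_eq_re_inner x := by
    change ‖(x : H)‖ ^ 2 = (sliceCoord m (hinner (x : H) (x : H))).re
    rw [hinner_self]
    rfl
  conj_inner_symm x y := by
    change conj (sliceCoord m (hinner (y : H) (x : H))) = sliceCoord m (hinner (x : H) (y : H))
    rw [← sliceCoord_star, star_hinner]
  add_left x y z := by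
    change sliceCoord m (hinner ((x : H) + y) (z : H)) = _
    rw [hinner_add_left, sliceCoord_add]
  smul_left x y z := by
    change sliceCoord m (hinner ((x : H) <• sliceEmb m z) (y : H)) = _
    rw [hinner_smul_left, star_sliceEmb, sliceCoord_mul]

/-- For anti self-adjoint `J`, the complex inner product of the slice space, read in `ℂ_m`, is the
quaternionic one. -/
theorem sliceEmb_inner (hJ : IsQAntiSelfAdjoint J) (a b : sliceSpace J m) :
    sliceEmb m (inner ℂ a b) = hinner (a : H) (b : H) := by
  apply sliceEmb_sliceCoord
  have ha : J (a : H) = (a : H) <• (m : ℍ[ℝ]) := a.2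
  have hb : J (b : H) = (b : H) <• (m : ℍ[ℝ]) := b.2
  have h := hJ (a : H) (b : H)
  have hneg : (-J) (a : H) = (a : H) <• (star (m : ℍ[ℝ])) := by
    rw [m.2.1, MulOpposite.op_neg, neg_smul, ← ha]
    rfl
  rwa [hneg, hb, hinner_smul, hinner_smul_left, star_star] at h

/-- `V` extends the operator `A` of the slice space: `V x = A x` for all `x ∈ H₊^{Jm}`. -/
def ExtendsSlice (A : sliceSpace J m →L[ℂ] sliceSpace J m) (V : H →ₗ[ℍ[ℝ]ᵐᵒᵖ] H) : Prop :=
  ∀ x : sliceSpace J m, V (x : H) = (A x : H)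

/-- `V = Ã`: `V` is the unique right `ℍ`-linear map on `H` that extends `A`. -/
def IsSliceExtension (A : sliceSpace J m →L[ℂ] sliceSpace J m) (V : H →L[ℍ[ℝ]ᵐᵒᵖ] H) : Prop :=
  ExtendsSlice A V ∧ ∀ W : H →ₗ[ℍ[ℝ]ᵐᵒᵖ] H, ExtendsSlice A W → W = V

end Operators

/-- `E` is the (complex) projection valued spectral measure of the bounded operator `A` on the
complex inner product space `K`: a map from the Borel subsets of `σ(A)` to the self-adjoint
projections on `K` that is multiplicative on intersections, for which every
`E_{a,b}(ω) = ⟨a | E(ω) b⟩` is a complex measure, and `⟨a | A b⟩ = ∫ λ dE_{a,b}(λ)`. -/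
structure IsSpectralMeasure {K : Type*} [NormedAddCommGroup K] [InnerProductSpace ℂ K]
    (A : K →L[ℂ] K)
    (E : {ω : Set (spectrum ℂ A) // MeasurableSet ω} → K →L[ℂ] K) : Prop where
  empty : E ∅ = 0
  univ : E ⟨Set.univ, MeasurableSet.univ⟩ = 1
  idem : ∀ ω, E ω * E ω = E ω
  selfAdjoint : ∀ ω (a b : K), inner ℂ a (E ω b) = inner ℂ (E ω a) b
  inter : ∀ ω₁ ω₂, E (ω₁ ∩ ω₂) = E ω₁ * E ω₂
  measure : ∀ a b : K, ∃ μ : VectorMeasure (spectrum ℂ A) ℂ,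
    (∀ ω, μ ω.1 = inner ℂ a (E ω b)) ∧
    inner ℂ a (A b) = μ.integral (fun z : spectrum ℂ A => (z : ℂ)) (ContinuousLinearMap.mul ℝ ℂ)

/-- `F` is a quaternionic projection valued measure on the measurable space `X`. -/
structure IsQPVM {H : Type*} [NormedAddCommGroup H] [QuaternionicInnerProductSpace H]
    {X : Type*} [MeasurableSpace X]
    (F : {ω : Set X // MeasurableSet ω} → H →L[ℍ[ℝ]ᵐᵒᵖ] H) : Prop where
  empty : F ∅ = 0
  univ : F ⟨Set.univ, MeasurableSet.univ⟩ = 1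
  idem : ∀ ω, F ω * F ω = F ω
  selfAdjoint : ∀ ω, IsQSelfAdjoint (F ω)
  inter : ∀ ω₁ ω₂, F (ω₁ ∩ ω₂) = F ω₁ * F ω₂
  measure : ∀ x y : H, ∃ ν : VectorMeasure X ℍ[ℝ],
    ∀ ω, ν ω.1 = hinner x (F ω y)

end

noncomputable section

open QuaternionicInnerProductSpace

/-! Since `J² = -1`, the map `P x = (x - J x m)/2` projects `H` onto `H₊`. Since `n` anticommutes
with `m`, right multiplication by `n` exchanges `H₊` with `{x | J x = -x m}`, so `H = H₊ ⊕ H₊ n`;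
explicitly `x = P x - P(x n) n` (`sliceProj_decomposition`). A right `ℍ`-linear map is therefore
determined by its values on `H₊`, and `A` extends by `Ã x = A(P x) - A(P(x n)) n`, continuous
because `P` and right multiplications are (`sliceExtension`).

Uniqueness makes `A ↦ Ã` preserve `0`, `1` and products, which transfers the algebraic laws of `E`.
For the rest, splitting both `x` and `y` writes `⟨x | Ã y⟩` through four complex entries `⟨a | A b⟩`
with `a, b ∈ H₊` (`hinner_sliceExtension`). Symmetry and countable additivity then pass from these
entries to the quaternionic one. -/

theorem imaginarySphere_mul_sliceEmb {m n : imaginarySphere} (hmn : (m : ℍ[ℝ]) * n = -(n * m))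
    (z : ℂ) : (n : ℍ[ℝ]) * sliceEmb m z = sliceEmb m (conj z) * n := by
  rw [sliceEmb_apply, sliceEmb_apply, Complex.conj_re, Complex.conj_im, mul_add, add_mul,
    Quaternion.coe_neg, mul_neg, neg_mul, Quaternion.coe_commutes, mul_assoc (m : ℍ[ℝ]),
    Quaternion.coe_commutes z.im (n : ℍ[ℝ]), ← mul_assoc, ← mul_assoc, hmn, neg_mul, neg_neg]

/-- `ℍ = ℂ_m + ℂ_m n` for anticommuting imaginary units `m`, `n`. -/
theorem exists_sliceEmb_add_sliceEmb_mul {m n : imaginarySphere}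
    (hmn : (m : ℍ[ℝ]) * n = -(n * m)) (q : ℍ[ℝ]) :
    ∃ z w : ℂ, q = sliceEmb m z + sliceEmb m w * n := by
  have hm := imaginarySphere_mul_self m
  have hn := imaginarySphere_mul_self n
  have hm' (r : ℍ[ℝ]) : (m : ℍ[ℝ]) * (m * r) = -r := by rw [← mul_assoc, hm, neg_one_mul]
  -- As `m⁻¹ = -m`, conjugation by `m` is the involution `q ↦ -m q m`. Its eigenparts `q₁` and `q₂`
  -- commute and anticommute with `m`.
  set q₁ : ℍ[ℝ] := (1 / 2 : ℝ) • (q - m * q * m) with hq₁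
  set q₂ : ℍ[ℝ] := (1 / 2 : ℝ) • (q + m * q * m) with hq₂
  have h₁ : q₁ * m = m * q₁ := by
    simp only [hq₁, smul_mul_assoc, mul_smul_comm, sub_mul, mul_sub, mul_assoc, hm, hm']
    simp [add_comm]
  have h₂ : q₂ * m = -(m * q₂) := by
    simp only [hq₂, smul_mul_assoc, mul_smul_comm, add_mul, mul_add, mul_assoc, hm, hm',
      ← smul_neg]
    congr 1
    simp
  -- A product of two elements anticommuting with `m` commutes with `m`; the sign is chosen so that
  -- `-(q₂ n) n = q₂`.
  have h₃ : -(q₂ * n) * m = m * -(q₂ * n) := by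
    have : (n : ℍ[ℝ]) * m = -(m * n) := by rw [hmn, neg_neg]
    rw [neg_mul, mul_neg, mul_assoc, this, mul_neg, ← mul_assoc, h₂, neg_mul, neg_neg, mul_assoc]
  refine ⟨sliceCoord m q₁, sliceCoord m (-(q₂ * n)), ?_⟩
  rw [sliceEmb_sliceCoord m h₁, sliceEmb_sliceCoord m h₃, neg_mul, mul_assoc, hn, mul_neg, mul_one,
    neg_neg, hq₁, hq₂, ← smul_add]
  have : q - m * q * m + (q + m * q * m) = (2 : ℝ) • q := by rw [two_smul]; abel
  rw [this, smul_smul]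
  norm_num

section SliceExtension

variable {H : Type*} [NormedAddCommGroup H] [QuaternionicInnerProductSpace H]

/-! ### Right scalars, adjoints and `J² = -1` -/

theorem right_smul_right_smul (x : H) (p q : ℍ[ℝ]) : (x <• p) <• q = x <• (p * q) := by
  rw [smul_smul, ← MulOpposite.op_mul]

theorem right_smul_neg (x : H) (q : ℍ[ℝ]) : x <• (-q) = -(x <• q) := by
  rw [MulOpposite.op_neg, neg_smul]

theorem continuous_right_smul (q : ℍ[ℝ]) : Continuous fun x : H => x <• q :=
  AddMonoidHomClass.continuous_of_bound (DistribSMul.toAddMonoidHom H (MulOpposite.op q)) ‖q‖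
    fun x => by
      rw [DistribSMul.toAddMonoidHom_apply, norm_right_smul, mul_comm]

theorem eq_zero_of_hinner_self {x : H} (h : hinner x x = 0) : x = 0 := by
  rw [hinner_self, ← Quaternion.coe_zero] at h
  simpa using Quaternion.coe_injective h

theorem hinner_neg_left (x y : H) : hinner (-x) y = -hinner x y := by
  rw [eq_neg_iff_add_eq_zero, ← hinner_add_left, neg_add_cancel]
  simpa using hinner_smul_left (0 : H) y 0

theorem IsQAdjoint.unique {T S S' : H →L[ℍ[ℝ]ᵐᵒᵖ] H} (h : IsQAdjoint T S)
    (h' : IsQAdjoint T S') : S = S' := by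
  ext x
  rw [← sub_eq_zero]
  apply eq_zero_of_hinner_self
  rw [sub_eq_add_neg, hinner_add_left, hinner_neg_left, ← sub_eq_add_neg, ← h, ← h', sub_self]

/-- Uniqueness of adjoints identifies the inverse supplied by unitarity with `-J`. -/
theorem IsQUnitary.apply_apply_of_antiSelfAdjoint {J : H →L[ℍ[ℝ]ᵐᵒᵖ] H} (hu : IsQUnitary J)
    (hJ : IsQAntiSelfAdjoint J) (x : H) : J (J x) = -x := by
  obtain ⟨S, hS, h, -⟩ := hu
  rw [hS.unique hJ] at h
  have := congrArg (fun V : H →L[ℍ[ℝ]ᵐᵒᵖ] H => V x) h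
  exact neg_eq_iff_eq_neg.mp this

/-! ### The splitting `H = H₊ ⊕ H₊ n` -/

variable {J : H →L[ℍ[ℝ]ᵐᵒᵖ] H} {m n : imaginarySphere}

/-- Halving is done with a real quaternion, since the scalar action given on `H` is the right action
of `ℍ`. -/
theorem half_add_half_right_smul (x : H) :
    (x + x) <• ((1 / 2 : ℝ) : ℍ[ℝ]) = x := by
  rw [smul_add, ← add_smul, ← MulOpposite.op_add, ← Quaternion.coe_add]
  norm_num

/-- The projection `x ↦ (x - J x m) / 2` of `H` onto the slice space. -/
def sliceProj (m : imaginarySphere) (hJJ : ∀ x, J (J x) = -x) : H →+ sliceSpace J m where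
  toFun x := ⟨(x - J x <• (m : ℍ[ℝ])) <• ((1 / 2 : ℝ) : ℍ[ℝ]), by
    -- Up to the factor `1/2`, both sides equal `J x + x m`, by `J² = -1` and `m² = -1`.
    change J _ = _
    rw [map_smul, map_sub, map_smul, hJJ, right_smul_right_smul, Quaternion.coe_commutes,
      ← right_smul_right_smul, smul_sub (MulOpposite.op (m : ℍ[ℝ])), right_smul_right_smul (J x),
      imaginarySphere_mul_self, right_smul_neg, MulOpposite.op_one, one_smul, smul_neg]
    congr 1
    abel⟩
  map_zero' := Subtype.ext <| by simp
  map_add' x y := Subtype.ext <| by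
    simp only [map_add, smul_add, AddSubgroup.coe_add, smul_sub]
    abel

variable {hJJ : ∀ x, J (J x) = -x}

theorem coe_sliceProj (x : H) : (sliceProj m hJJ x : H) =
    (x - J x <• (m : ℍ[ℝ])) <• ((1 / 2 : ℝ) : ℍ[ℝ]) := rfl

theorem sliceProj_coe (a : sliceSpace J m) : sliceProj m hJJ (a : H) = a := by
  have ha : J (a : H) = (a : H) <• (m : ℍ[ℝ]) := a.2
  apply Subtype.ext
  rw [coe_sliceProj, ha, right_smul_right_smul, imaginarySphere_mul_self, right_smul_neg,
    sub_neg_eq_add, MulOpposite.op_one, one_smul, half_add_half_right_smul]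

/-- Anticommutation puts `a n` in `{x | J x = -x m}`, the kernel of the projection. -/
theorem sliceProj_coe_right_smul (hmn : (m : ℍ[ℝ]) * n = -(n * m)) (a : sliceSpace J m) :
    sliceProj m hJJ ((a : H) <• (n : ℍ[ℝ])) = 0 := by
  have ha : J (a : H) = (a : H) <• (m : ℍ[ℝ]) := a.2
  apply Subtype.ext
  rw [coe_sliceProj, map_smul, ha, right_smul_right_smul, right_smul_right_smul,
    ← mul_assoc, hmn, neg_mul, mul_assoc, imaginarySphere_mul_self]
  simp

theorem sliceProj_right_smul_sliceEmb (x : H) (z : ℂ) :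
    sliceProj m hJJ (x <• sliceEmb m z) = z • sliceProj m hJJ x := by
  apply Subtype.ext
  rw [sliceSpace.coe_smul, coe_sliceProj, coe_sliceProj, map_smul, right_smul_right_smul,
    ← mul_sliceEmb_comm, ← right_smul_right_smul, ← smul_sub, right_smul_right_smul,
    right_smul_right_smul, Quaternion.coe_commutes]

theorem right_smul_self_self (x : H) : (x <• (n : ℍ[ℝ])) <• (n : ℍ[ℝ]) = -x := by
  rw [right_smul_right_smul, imaginarySphere_mul_self, right_smul_neg, MulOpposite.op_one, one_smul]

/-- `H = H₊ + H₊ n`. -/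
theorem sliceProj_decomposition (hmn : (m : ℍ[ℝ]) * n = -(n * m)) (x : H) :
    x = sliceProj m hJJ x - (sliceProj m hJJ (x <• (n : ℍ[ℝ])) : H) <• (n : ℍ[ℝ]) := by
  -- The sign flip gives `P(x n) n = -(x + J x m)/2`, minus the complementary projection of `x`.
  have key : J (x <• (n : ℍ[ℝ])) <• (m : ℍ[ℝ]) = -((J x <• (m : ℍ[ℝ])) <• (n : ℍ[ℝ])) := by
    rw [map_smul, right_smul_right_smul, right_smul_right_smul, hmn, right_smul_neg, neg_neg]
  rw [coe_sliceProj, coe_sliceProj, key, sub_neg_eq_add, right_smul_right_smul _ _ (n : ℍ[ℝ]),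
    Quaternion.coe_commutes, ← right_smul_right_smul, smul_add (MulOpposite.op (n : ℍ[ℝ])),
    right_smul_self_self, right_smul_self_self, ← smul_sub]
  conv_lhs => rw [← half_add_half_right_smul x]
  congr 1
  abel

theorem continuous_sliceProj : Continuous (sliceProj m hJJ) :=
  Continuous.subtype_mk ((continuous_right_smul _).comp
    (continuous_id.sub ((continuous_right_smul _).comp J.continuous))) _

/-! ### Extending operators from `H₊` to `H` -/

/-- The right `ℍ`-linear extension of an operator on the slice space. -/
def sliceExtension (hJJ : ∀ x, J (J x) = -x) (hmn : (m : ℍ[ℝ]) * n = -(n * m))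
    (A : sliceSpace J m →L[ℂ] sliceSpace J m) : H →L[ℍ[ℝ]ᵐᵒᵖ] H where
  toFun x := A (sliceProj m hJJ x) - (A (sliceProj m hJJ (x <• (n : ℍ[ℝ]))) : H) <• (n : ℍ[ℝ])
  map_add' x y := by
    simp only [smul_add, map_add, AddSubgroup.coe_add]
    abel
  map_smul' q x := by
    obtain ⟨q, rfl⟩ := MulOpposite.op_surjective q
    -- As `ℍ = ℂ_m + ℂ_m n`, homogeneity follows from additivity (`hadd`) and the scalars in `ℂ_m`
    -- (`hz`) and `n` (`hn`). In `hz`, moving `z` past `n` twice conjugates it twice; in `hn`, `n² =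
    -- -1` exchanges the two summands.
    have hadd (x y : H) :
        (A (sliceProj m hJJ (x + y)) : H) -
            (A (sliceProj m hJJ ((x + y) <• (n : ℍ[ℝ]))) : H) <• (n : ℍ[ℝ]) =
          ((A (sliceProj m hJJ x) : H) -
            (A (sliceProj m hJJ (x <• (n : ℍ[ℝ]))) : H) <• (n : ℍ[ℝ])) +
          ((A (sliceProj m hJJ y) : H) -
            (A (sliceProj m hJJ (y <• (n : ℍ[ℝ]))) : H) <• (n : ℍ[ℝ])) := by
      simp only [smul_add, map_add, AddSubgroup.coe_add]
      abel
    have hz (x : H) (z : ℂ) :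
        (A (sliceProj m hJJ (x <• sliceEmb m z)) : H) -
            (A (sliceProj m hJJ ((x <• sliceEmb m z) <• (n : ℍ[ℝ]))) : H) <• (n : ℍ[ℝ]) =
          ((A (sliceProj m hJJ x) : H) -
            (A (sliceProj m hJJ (x <• (n : ℍ[ℝ]))) : H) <• (n : ℍ[ℝ])) <• sliceEmb m z := by
      have h := imaginarySphere_mul_sliceEmb hmn
      have h' : sliceEmb m z * (n : ℍ[ℝ]) = n * sliceEmb m (conj z) := by
        rw [h, Complex.conj_conj]
      rw [right_smul_right_smul, h', ← right_smul_right_smul, sliceProj_right_smul_sliceEmb,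
        sliceProj_right_smul_sliceEmb, map_smul, map_smul, sliceSpace.coe_smul,
        sliceSpace.coe_smul, smul_sub, right_smul_right_smul, right_smul_right_smul, h]
    have hn (x : H) :
        (A (sliceProj m hJJ (x <• (n : ℍ[ℝ]))) : H) -
            (A (sliceProj m hJJ ((x <• (n : ℍ[ℝ])) <• (n : ℍ[ℝ]))) : H) <• (n : ℍ[ℝ]) =
          ((A (sliceProj m hJJ x) : H) -
            (A (sliceProj m hJJ (x <• (n : ℍ[ℝ]))) : H) <• (n : ℍ[ℝ])) <• (n : ℍ[ℝ]) := by
      rw [right_smul_self_self, map_neg, map_neg, smul_sub, right_smul_self_self,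
        AddSubgroup.coe_neg, smul_neg]
      abel
    obtain ⟨z, w, rfl⟩ := exists_sliceEmb_add_sliceEmb_mul hmn q
    simp only [RingHom.id_apply, MulOpposite.op_add, add_smul]
    rw [hadd, hz, ← right_smul_right_smul, hn, hz, right_smul_right_smul]
  cont := by
    exact (continuous_subtype_val.comp (A.continuous.comp continuous_sliceProj)).sub
      ((continuous_right_smul _).comp (continuous_subtype_val.comp
        (A.continuous.comp (continuous_sliceProj.comp (continuous_right_smul _)))))

theorem sliceExtension_apply (hmn : (m : ℍ[ℝ]) * n = -(n * m))
    (A : sliceSpace J m →L[ℂ] sliceSpace J m) (x : H) :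
    sliceExtension hJJ hmn A x = A (sliceProj m hJJ x) -
      (A (sliceProj m hJJ (x <• (n : ℍ[ℝ]))) : H) <• (n : ℍ[ℝ]) := rfl

theorem ExtendsSlice.unique (hJJ : ∀ x, J (J x) = -x) (hmn : (m : ℍ[ℝ]) * n = -(n * m))
    {A : sliceSpace J m →L[ℂ] sliceSpace J m} {V W : H →ₗ[ℍ[ℝ]ᵐᵒᵖ] H}
    (hV : ExtendsSlice A V) (hW : ExtendsSlice A W) : V = W := by
  ext x
  rw [sliceProj_decomposition (hJJ := hJJ) hmn x, map_sub, map_sub, V.map_smul, W.map_smul, hV,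
    hV, hW, hW]

theorem extendsSlice_sliceExtension (hmn : (m : ℍ[ℝ]) * n = -(n * m))
    (A : sliceSpace J m →L[ℂ] sliceSpace J m) :
    ExtendsSlice A (sliceExtension hJJ hmn A : H →ₗ[ℍ[ℝ]ᵐᵒᵖ] H) := fun a => by
  rw [ContinuousLinearMap.coe_coe, sliceExtension_apply, sliceProj_coe,
    sliceProj_coe_right_smul hmn]
  simp

theorem isSliceExtension_sliceExtension (hmn : (m : ℍ[ℝ]) * n = -(n * m))
    (A : sliceSpace J m →L[ℂ] sliceSpace J m) :
    IsSliceExtension A (sliceExtension hJJ hmn A) :=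
  ⟨extendsSlice_sliceExtension hmn A,
    fun _ hW => hW.unique hJJ hmn (extendsSlice_sliceExtension hmn A)⟩

/-- Reduces identities between extensions to a check on `H₊`. -/
theorem sliceExtension_eq (hmn : (m : ℍ[ℝ]) * n = -(n * m))
    {A : sliceSpace J m →L[ℂ] sliceSpace J m} {V : H →L[ℍ[ℝ]ᵐᵒᵖ] H}
    (hV : ExtendsSlice A (V : H →ₗ[ℍ[ℝ]ᵐᵒᵖ] H)) : sliceExtension hJJ hmn A = V :=
  ContinuousLinearMap.coe_injective ((extendsSlice_sliceExtension hmn A).unique hJJ hmn hV)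

theorem sliceExtension_zero (hmn : (m : ℍ[ℝ]) * n = -(n * m)) :
    sliceExtension hJJ hmn 0 = 0 :=
  sliceExtension_eq hmn fun _ => rfl

theorem sliceExtension_one (hmn : (m : ℍ[ℝ]) * n = -(n * m)) :
    sliceExtension hJJ hmn 1 = 1 :=
  sliceExtension_eq hmn fun _ => rfl

theorem sliceExtension_mul (hmn : (m : ℍ[ℝ]) * n = -(n * m))
    (A B : sliceSpace J m →L[ℂ] sliceSpace J m) :
    sliceExtension hJJ hmn (A * B) = sliceExtension hJJ hmn A * sliceExtension hJJ hmn B :=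
  sliceExtension_eq hmn fun a => by
    have hA := extendsSlice_sliceExtension (hJJ := hJJ) hmn A
    have hB := extendsSlice_sliceExtension (hJJ := hJJ) hmn B
    change sliceExtension hJJ hmn A (sliceExtension hJJ hmn B a) = (A (B a) : H)
    exact (congrArg _ (hB a)).trans (hA (B a))

/-! ### Matrix entries of an extension -/

theorem hinner_sub_right (x y z : H) : hinner x (y - z) = hinner x y - hinner x z := by
  rw [eq_sub_iff_add_eq, ← hinner_add, sub_add_cancel]

theorem hinner_sub_left (x y z : H) : hinner (x - y) z = hinner x z - hinner y z := by
  rw [eq_sub_iff_add_eq, ← hinner_add_left, sub_add_cancel]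

/-- Both arguments are split along `H₊ ⊕ H₊ n`; the unit `n` leaves the first slot on the left as
`star n`, the second on the right. The remaining entries pair vectors of `H₊`, so `sliceEmb_inner`
makes them complex. -/
theorem hinner_sliceExtension (hJ : IsQAntiSelfAdjoint J) (hmn : (m : ℍ[ℝ]) * n = -(n * m))
    (A : sliceSpace J m →L[ℂ] sliceSpace J m) (x y : H) :
    hinner x (sliceExtension hJJ hmn A y) =
      sliceEmb m (inner ℂ (sliceProj m hJJ x) (A (sliceProj m hJJ y))) -
      sliceEmb m (inner ℂ (sliceProj m hJJ x) (A (sliceProj m hJJ (y <• (n : ℍ[ℝ]))))) * n -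
      star (n : ℍ[ℝ]) *
        (sliceEmb m (inner ℂ (sliceProj m hJJ (x <• (n : ℍ[ℝ]))) (A (sliceProj m hJJ y))) -
        sliceEmb m (inner ℂ (sliceProj m hJJ (x <• (n : ℍ[ℝ])))
          (A (sliceProj m hJJ (y <• (n : ℍ[ℝ]))))) * n) := by
  conv_lhs => rw [sliceProj_decomposition (hJJ := hJJ) hmn x]
  simp only [sliceExtension_apply, sliceEmb_inner hJ, hinner_sub_left, hinner_smul_left,
    hinner_sub_right, hinner_smul, mul_sub, sub_mul, mul_assoc]
  abel

theorem isQSelfAdjoint_sliceExtension (hJ : IsQAntiSelfAdjoint J)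
    (hmn : (m : ℍ[ℝ]) * n = -(n * m)) {A : sliceSpace J m →L[ℂ] sliceSpace J m}
    (hA : ∀ a b, inner ℂ a (A b) = inner ℂ (A a) b) :
    IsQSelfAdjoint (sliceExtension hJJ hmn A) := fun x y => by
  rw [hinner_sliceExtension hJ]
  conv_rhs => rw [sliceProj_decomposition (hJJ := hJJ) hmn y]
  simp only [hA, sliceExtension_apply, sliceEmb_inner hJ, hinner_sub_left, hinner_smul_left,
    hinner_sub_right, hinner_smul, mul_sub, sub_mul, mul_assoc]
  abel

theorem continuous_sliceEmb (m : imaginarySphere) : Continuous (sliceEmb m) :=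
  (sliceEmb m).toLinearMap.continuous_of_finiteDimensional

/-- The measure is assembled from the four complex measures of `hinner_sliceExtension`. The
embedding of `ℂ` and multiplication by a fixed quaternion are continuous and additive, so `mapRange`
along them preserves countable additivity. -/
theorem exists_vectorMeasure_hinner_sliceExtension (hJ : IsQAntiSelfAdjoint J)
    (hmn : (m : ℍ[ℝ]) * n = -(n * m)) {X : Type*} [MeasurableSpace X]
    {E : {ω : Set X // MeasurableSet ω} → sliceSpace J m →L[ℂ] sliceSpace J m}
    (hE : ∀ a b, ∃ μ : VectorMeasure X ℂ, ∀ ω, μ ω.1 = inner ℂ a (E ω b)) (x y : H) :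
    ∃ ν : VectorMeasure X ℍ[ℝ], ∀ ω, ν ω.1 = hinner x (sliceExtension hJJ hmn (E ω) y) := by
  choose μ hμ using hE
  have hc := continuous_sliceEmb m
  let μ' (a b : sliceSpace J m) := (μ a b).mapRange (sliceEmb m : ℂ →+ ℍ[ℝ]) hc
  have hμ' (a b ω) : μ' a b ω.1 = sliceEmb m (inner ℂ a (E ω b)) := by
    rw [← hμ]
    exact VectorMeasure.mapRange_apply _ _
  have hr : Continuous (AddMonoidHom.mulRight (n : ℍ[ℝ])) := continuous_mul_const _
  have hl : Continuous (AddMonoidHom.mulLeft (star (n : ℍ[ℝ]))) := continuous_const_mul _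
  let R (μ₁ μ₂ : VectorMeasure X ℍ[ℝ]) : VectorMeasure X ℍ[ℝ] :=
    μ₁ - μ₂.mapRange (AddMonoidHom.mulRight (n : ℍ[ℝ])) hr
  have hR (μ₁ μ₂ s) : R μ₁ μ₂ s = μ₁ s - μ₂ s * n := by
    simp [R]
  let P := sliceProj m hJJ
  refine ⟨R (μ' (P x) (P y)) (μ' (P x) (P (y <• (n : ℍ[ℝ])))) -
    (R (μ' (P (x <• (n : ℍ[ℝ]))) (P y))
      (μ' (P (x <• (n : ℍ[ℝ]))) (P (y <• (n : ℍ[ℝ]))))).mapRange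
        (AddMonoidHom.mulLeft (star (n : ℍ[ℝ]))) hl, fun ω => ?_⟩
  rw [hinner_sliceExtension hJ, sub_apply, VectorMeasure.mapRange_apply, hR, hR,
    hμ', hμ', hμ', hμ']
  rfl

end SliceExtension

end

theorem mainTheorem2 {H : Type*} [NormedAddCommGroup H] [QuaternionicInnerProductSpace H]
    [CompleteSpace H] (m n : imaginarySphere) (hmn : (m : ℍ[ℝ]) * n = -(n * m))
    (T J : H →L[ℍ[ℝ]ᵐᵒᵖ] H) (hT : IsQNormal T)
    (hJ : IsQAntiSelfAdjoint J) (hJu : IsQUnitary J)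
    (Tp : sliceSpace J m →L[ℂ] sliceSpace J m) (hTp : ExtendsSlice Tp T)
    (E : {ω : Set (spectrum ℂ Tp) // MeasurableSet ω} → sliceSpace J m →L[ℂ] sliceSpace J m)
    (hE : IsSpectralMeasure Tp E) :
    ∃ F : {ω : Set (spectrum ℂ Tp) // MeasurableSet ω} → H →L[ℍ[ℝ]ᵐᵒᵖ] H,
      (∀ ω, IsSliceExtension (E ω) (F ω)) ∧ IsQPVM F := by
  have hJJ := hJu.apply_apply_of_antiSelfAdjoint hJ
  refine ⟨fun ω => sliceExtension hJJ hmn (E ω),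
    fun ω => isSliceExtension_sliceExtension hmn (E ω), ?_, ?_, fun ω => ?_, fun ω => ?_,
    fun ω₁ ω₂ => ?_, ?_⟩
  · rw [hE.empty, sliceExtension_zero]
  · rw [hE.univ, sliceExtension_one]
  · rw [← sliceExtension_mul, hE.idem]
  · exact isQSelfAdjoint_sliceExtension hJ hmn (hE.selfAdjoint ω)
  · rw [hE.inter, sliceExtension_mul]
  · exact exists_vectorMeasure_hinner_sliceExtension hJ hmn
      fun a b => (hE.measure a b).imp fun _ h => h.1
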